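/- Let $\mathcal S\subset\mathbb R^n$ and $\mathcal A\subset\mathbb R^d$ be compact, let $P(\cdot\mid s,a)$ be a Markov transition kernel from $\mathcal S\times\mathcal A$ to $\mathcal S$, let $\mu_0$ be an initial state distribution, $\gamma\in[0,1)$ a discount factor, $\beta\in(0,1]$ a CVaR level, $r_0,\dots,r_m:\mathcal S\times\mathcal A\to\mathbb R$ bounded measurable rewards and $c_1,\dots,c_m\in\mathbb R$. A policy $\pi$ is a Markov kernel from $\mathcal S$ to $\mathcal A$, and $(s_\tau^\pi,a_\tau^\pi)_{\tau\ge 0}$ is the induced state-action process. With $r_i'(s,a,u)=u-\frac1\beta(u-r_i(s,a))_+$, put $$V_i(\pi,u)=\mathbb E\Big[\sum_{\tau\ge0}\gamma^\tau r_i'(s^\pi_\tau,a^\pi_\tau,u)\Big],\qquad \mathcal L(\pi,t,\lambda)=V_0(\pi,t_0)+\sum_{i=1}^m\lambda_i\big(V_i(\pi,t_i)-c_i\big)$$ for $t=(t_0,\dots,t_m)\in\mathbb R^{m+1}$ and $\lambda\in\mathbb R^m_{\ge 0}$, and $P^*(t)=\sup_\pi\inf_{\lambda\ge0}\mathcal L(\pi,t,\lambda)$.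 A pair $(\pi,t)$ is feasible if $V_i(\pi,t_i)\ge c_i$ for $i=1,\dots,m$. Let $\mathcal T\subset\mathbb R^{m+1}$ be a compact convex set that contains $\prod_{i=0}^m[\inf r_i,\sup r_i]$, and let $t^*\in\mathcal T$ attain the maximum over $t\in\mathcal T$ of $\sup\{V_0(\pi,t_0):(\pi,t)\text{ feasible}\}$. Let $\mathcal I\subset\mathcal T$ be compact and convex with $t^*\in\mathcal I$, and assume Slater's condition at every $t\in\mathcal I$: there is a policy $\pi$ with $V_i(\pi,t_i)>c_i$ for $i=1,\dots,m$. Then $P^*(t^*)=\sup_{t\in\mathcal I}P^*(t)$, and there are constants $G\ge0$ and $\epsilon_0>0$, depending on the above data (including $\gamma$) but neither on $\epsilon$ nor on the parametrization below, such that the following holds. Let $\epsilon>0$ and let $(\pi_\theta)_{\theta\in\Theta}$, with $\Theta\subset\mathbb R^p$ compact, be an $\epsilon$-universal family of policies, i.e. for every policy $\pi$ there is $\theta\in\Theta$ with $\int_{\mathcal A}|\pi(da\mid s)-\pi_\theta(da\mid s)|\le\epsilon$ (total variation norm) for all $s\in\mathcal S$. Suppose that $(\pi_\theta,t)$ is feasible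 for some $\theta\in\Theta$ and $t\in\mathcal T$. Then $$P^*(t^*)\ \ge\ \sup_{t\in\mathcal I}\inf_{\lambda\ge0}\sup_{\theta\in\Theta}\mathcal L(\pi_\theta,t,\lambda),$$ and, if $\epsilon\le\epsilon_0$ or if $(\pi_\theta,t)$ is feasible for some $\theta\in\Theta$ and some $t\in\mathcal I$, also $$\sup_{t\in\mathcal I}\inf_{\lambda\ge0}\sup_{\theta\in\Theta}\mathcal L(\pi_\theta,t,\lambda)\ \ge\ P^*(t^*)-G\,\frac{\epsilon}{1-\gamma}.$$ -/

import Mathlib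

open MeasureTheory ProbabilityTheory
open scoped NNReal

noncomputable section

/-- The data of a reward-based risk-constrained reinforcement learning problem:
compact state and action sets in Euclidean spaces (with their Borel sigma-algebras), a Markovian
transition law, an initial state distribution, bounded measurable rewards `r 0` (objective) and
`r 1, ..., r m` (constraints), thresholds `c`, a discount factor `γ` and a CVaR level `β`. -/
structure RiskCMDP (n d m : ℕ) where
  S : Set (EuclideanSpace ℝ (Fin n))
  isCompact_S : IsCompact S
  A : Set (EuclideanSpace ℝ (Fin d))
  isCompact_A : IsCompact A
  transition : Kernel (S × A) S
  isMarkovKernel_transition : IsMarkovKernel transition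
  init : Measure S
  isProbabilityMeasure_init : IsProbabilityMeasure init
  r : Fin (m + 1) → S × A → ℝ
  measurable_r : ∀ i, Measurable (r i)
  bounded_r : ∃ B : ℝ, ∀ i x, |r i x| ≤ B
  c : Fin m → ℝ
  γ : ℝ
  γ_nonneg : 0 ≤ γ
  γ_lt_one : γ < 1
  β : ℝ
  β_pos : 0 < β
  β_le_one : β ≤ 1

namespace RiskCMDP

attribute [instance] isMarkovKernel_transition isProbabilityMeasure_init

variable {n d m : ℕ} (M : RiskCMDP n d m)

/-- Policies: probability measures on the action set, measurably parametrized by the state. -/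
structure Policy where
  kernel : Kernel M.S M.A
  isMarkovKernel_kernel : IsMarkovKernel kernel

attribute [instance] Policy.isMarkovKernel_kernel

variable {M}

/-- One step of the state-action process: draw the next state, then an action there. -/
def step (π : M.Policy) : Kernel (M.S × M.A) (M.S × M.A) :=
  M.transition.compProd (π.kernel.prodMkLeft (M.S × M.A))

instance (π : M.Policy) : IsMarkovKernel (step π) := by
  unfold step; infer_instance

/-- The law of the next state-action pair given the history up to time `τ`; by the Markov
property it only depends on the last pair of the history. -/
def historyKernel (π : M.Policy) (τ : ℕ) :
    Kernel ((i : Finset.Iic τ) → (fun _ : ℕ => M.S × M.A) i) ((fun _ : ℕ => M.S × M.A) (τ + 1)) :=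
  (step π).comap (fun h => h ⟨τ, Finset.mem_Iic.2 le_rfl⟩) (measurable_pi_apply _)

instance (π : M.Policy) (τ : ℕ) : IsMarkovKernel (historyKernel π τ) := by
  unfold historyKernel; infer_instance

/-- The law of the whole state-action trajectory under the policy `π`. -/
def pathMeasure (π : M.Policy) : Measure (ℕ → M.S × M.A) :=
  Kernel.trajMeasure (X := fun _ : ℕ => M.S × M.A) (M.init.compProd π.kernel) (historyKernel π)

/-- The modified reward `r'ᵢ(s, a, u) = u - (1/β) (u - rᵢ(s, a))₊`. -/
def modReward (M : RiskCMDP n d m) (i : Fin (m + 1)) (u : ℝ) (x : M.S × M.A) : ℝ :=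
  u - 1 / M.β * max (u - M.r i x) 0

/-- The expected discounted sum of the `i`-th modified reward along the process under `π`. -/
def value (π : M.Policy) (i : Fin (m + 1)) (u : ℝ) : ℝ :=
  ∫ ω, ∑' τ : ℕ, M.γ ^ τ * modReward M i u (ω τ) ∂(pathMeasure π)

/-- `π` satisfies all the constraints at `t`. -/
def Feasible (π : M.Policy) (t : Fin (m + 1) → ℝ) : Prop :=
  ∀ i : Fin m, M.c i ≤ value π i.succ (t i.succ)

/-- The Lagrangian of the constrained problem over `(π, t)`. -/
def lagrangian (π : M.Policy) (t : Fin (m + 1) → ℝ) (l : Fin m → ℝ≥0) : ℝ :=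
  value π 0 (t 0) + ∑ i : Fin m, (l i : ℝ) * (value π i.succ (t i.succ) - M.c i)

variable (M)

/-- Slater's condition for the problem at fixed `t`: there is a strictly feasible policy. -/
def Slater (t : Fin (m + 1) → ℝ) : Prop :=
  ∃ π : M.Policy, ∀ i : Fin m, M.c i < value π i.succ (t i.succ)

/-- Optimal value of the constrained problem at fixed `t`
(`⊥` if no policy is feasible). -/
def fixedValue (t : Fin (m + 1) → ℝ) : EReal :=
  ⨆ (π : M.Policy) (_ : Feasible π t), ((value π 0 (t 0) : ℝ) : EReal)

/-- `P*(t) = sup_π inf_{λ ≥ 0} L(π, t, λ)`. -/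
def primal (t : Fin (m + 1) → ℝ) : EReal :=
  ⨆ π : M.Policy, ⨅ l : Fin m → ℝ≥0, ((lagrangian π t l : ℝ) : EReal)

/-- `T` is an admissible search region for `t`: compact, convex, and containing every `t` whose
coordinates lie between the smallest and the largest values of the corresponding rewards. -/
structure IsRegion (T : Set (Fin (m + 1) → ℝ)) : Prop where
  isCompact : IsCompact T
  convex : Convex ℝ T
  contains : ∀ t : Fin (m + 1) → ℝ, (∀ i, ⨅ x, M.r i x ≤ t i ∧ t i ≤ ⨆ x, M.r i x) → t ∈ T

/-- The constraint qualification: `tstar` attains the maximum over `t ∈ T` in the joint constrained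
problem, and Slater's condition holds on the compact convex set `I ⊆ T`, which contains `tstar`. -/
structure ConstraintQualification (T I : Set (Fin (m + 1) → ℝ)) (tstar : Fin (m + 1) → ℝ) :
    Prop where
  mem_T : tstar ∈ T
  isMax : ∀ t ∈ T, fixedValue M t ≤ fixedValue M tstar
  subset : I ⊆ T
  isCompact : IsCompact I
  convex : Convex ℝ I
  mem_I : tstar ∈ I
  slater : ∀ t ∈ I, M.Slater t

variable {M}

/-- `ε`-universality of a family of policies: every policy is, uniformly over states, within
`ε` of some member of the family in the total variation norm `∫ |π(da|s) - π_θ(da|s)|`. -/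
def IsUniversal {Θ : Type*} (pol : Θ → M.Policy) (ε : ℝ) : Prop :=
  ∀ π : M.Policy, ∃ θ : Θ, ∀ s : M.S,
    ((π.kernel s).toSignedMeasure - ((pol θ).kernel s).toSignedMeasure).totalVariation Set.univ
      ≤ ENNReal.ofReal ε

/-- The parametrized partial dual value `sup_{t ∈ I} inf_{λ ≥ 0} sup_θ L(π_θ, t, λ)`. -/
def paramDual {Θ : Type*} (pol : Θ → M.Policy) (I : Set (Fin (m + 1) → ℝ)) : EReal :=
  ⨆ t ∈ I, ⨅ l : Fin m → ℝ≥0, ⨆ θ : Θ, ((lagrangian (pol θ) t l : ℝ) : EReal)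

end RiskCMDP

end

open scoped ENNReal

namespace RiskCMDP

noncomputable section

variable {n d m : ℕ} {M : RiskCMDP n d m}

/-! For fixed `t` the problem is linear in disguise: each value is the integral of a modified reward
against the discounted occupation measure, and these measures form a convex set
(`exists_occupation_eq_add`). So the attainable value vectors are convex, and Slater's condition
yields an exact multiplier by separation (`exists_lagrange_multiplier`). Restricting to a
parametrized family only lowers the supremum, so the parametrized dual at `t ∈ I` is at most
`P*(t)`, hence at most `P*(tstar)`.

For the lower bound take `t = tstar`. Policies within `ε` in total variation have values within `D *
ε` (`abs_value_sub_le`). Given `λ`, approximate a feasible policy if `∑ λ` is below a fixed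
threshold, so that the error is `O(ε)`; above the threshold approximate the Slater policy, whose
margin, multiplied by `∑ λ`, already beats every attainable objective (`exists_lagrangian_ge`). This
needs `ε` small. For large `ε` one feasible parametrized policy at some `t ∈ I` suffices, since all
objective values lie in `[-K, K]`. -/

instance (π : M.Policy) : IsProbabilityMeasure (pathMeasure π) := by
  unfold pathMeasure; infer_instance

/-! ### Occupation measures: flow equation, uniqueness, convexity. -/

/-- The law of the state-action pair at time `τ`. -/
def pairLaw (π : M.Policy) (τ : ℕ) : Measure (M.S × M.A) :=
  (pathMeasure π).map (fun ω => ω τ)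

instance (π : M.Policy) (τ : ℕ) : IsProbabilityMeasure (pairLaw π τ) :=
  Measure.isProbabilityMeasure_map (measurable_pi_apply τ).aemeasurable

lemma pairLaw_zero (π : M.Policy) : pairLaw π 0 = M.init.compProd π.kernel := by
  have h : (fun ω : ℕ → M.S × M.A => ω 0) =
      (fun x : ((i : Finset.Iic 0) → (fun _ : ℕ => M.S × M.A) i) =>
        x ⟨0, Finset.mem_Iic.2 le_rfl⟩) ∘ Preorder.frestrictLe (π := fun _ : ℕ => M.S × M.A) 0 := rfl
  rw [pairLaw, h, ← Measure.map_map (measurable_pi_apply _) (by fun_prop), pathMeasure,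
    Kernel.trajMeasure, Measure.map_comp _ _ (by fun_prop), Kernel.traj_map_frestrictLe,
    Kernel.partialTraj_self, Measure.id_comp, Measure.map_map (measurable_pi_apply _) (by fun_prop)]
  exact Measure.map_id

lemma pairLaw_succ (π : M.Policy) (τ : ℕ) :
    pairLaw π (τ + 1) = (step π : M.S × M.A → Measure (M.S × M.A)) ∘ₘ pairLaw π τ := by
  have h := Kernel.map_frestrictLe_trajMeasure_compProd_eq_map_trajMeasure
    (X := fun _ : ℕ => M.S × M.A) (κ := historyKernel π) (μ₀ := M.init.compProd π.kernel) (a := τ)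
  have h' := congrArg Measure.snd h
  rw [Measure.snd_compProd] at h'
  have e : pairLaw π (τ + 1) = (Measure.map (fun x : ℕ → M.S × M.A =>
      (Preorder.frestrictLe (π := fun _ : ℕ => M.S × M.A) τ x, x (τ + 1)))
      (pathMeasure π)).snd := by
    rw [Measure.snd, Measure.map_map measurable_snd (by fun_prop)]; rfl
  rw [e]
  refine h'.symm.trans ?_
  ext s hs
  rw [Measure.bind_apply hs (Kernel.aemeasurable _), Measure.bind_apply hs (Kernel.aemeasurable _),
    pairLaw, lintegral_map (Kernel.measurable_coe _ hs) (by fun_prop),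
    lintegral_map (Kernel.measurable_coe _ hs) (measurable_pi_apply τ)]
  rfl

/-- The unnormalized discounted occupation measure of a policy. -/
def occupation (π : M.Policy) : Measure (M.S × M.A) :=
  Measure.sum fun τ => ENNReal.ofReal M.γ ^ τ • pairLaw π τ

lemma occupation_univ (π : M.Policy) :
    occupation π Set.univ = (1 - ENNReal.ofReal M.γ)⁻¹ := by
  simp [occupation, Measure.sum_apply, ENNReal.tsum_geometric]

lemma one_sub_discount_pos (M : RiskCMDP n d m) : 0 < 1 - ENNReal.ofReal M.γ := by
  rw [tsub_pos_iff_lt]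
  exact ENNReal.ofReal_lt_one.2 M.γ_lt_one

instance (π : M.Policy) : IsFiniteMeasure (occupation π) where
  measure_univ_lt_top := by
    rw [occupation_univ]
    exact ENNReal.inv_lt_top.2 (one_sub_discount_pos M)

lemma occupation_eq (π : M.Policy) :
    occupation π = M.init.compProd π.kernel +
      ENNReal.ofReal M.γ • ((step π : M.S × M.A → Measure (M.S × M.A)) ∘ₘ occupation π) := by
  have h : (step π : M.S × M.A → Measure (M.S × M.A)) ∘ₘ occupation π =
      Measure.sum fun τ => ENNReal.ofReal M.γ ^ τ • pairLaw π (τ + 1) := by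
    rw [occupation, Measure.bind_sum _ _ (Kernel.aemeasurable _)]
    congr 1
    ext1 τ
    rw [Measure.bind_smul, pairLaw_succ]
  rw [h]
  ext s hs
  rw [occupation, Measure.sum_apply _ hs, tsum_eq_zero_add' ENNReal.summable, Measure.add_apply,
    Measure.smul_apply (ENNReal.ofReal M.γ), Measure.sum_apply _ hs, smul_eq_mul,
    ← ENNReal.tsum_mul_left]
  simp [pairLaw_zero, pow_succ', mul_assoc]

/-- The partial sums are the iterates, started at `0`, of the monotone affine map on the right of
`h`; a fixed point dominates them all. -/
lemma sum_le_of_fixed_point (π : M.Policy) (ρ : Measure (M.S × M.A))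
    (h : ρ = M.init.compProd π.kernel +
      ENNReal.ofReal M.γ • ((step π : M.S × M.A → Measure (M.S × M.A)) ∘ₘ ρ)) (N : ℕ) :
    ∑ τ ∈ Finset.range N, ENNReal.ofReal M.γ ^ τ • pairLaw π τ ≤ ρ := by
  have hb : ∀ K : ℕ, (step π : M.S × M.A → Measure (M.S × M.A)) ∘ₘ
        ∑ τ ∈ Finset.range K, ENNReal.ofReal M.γ ^ τ • pairLaw π τ =
      ∑ τ ∈ Finset.range K, ENNReal.ofReal M.γ ^ τ • pairLaw π (τ + 1) := by
    intro K
    induction K with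
    | zero => simp
    | succ K ih =>
      rw [Finset.sum_range_succ, Measure.comp_add, ih, Finset.sum_range_succ,
        Measure.bind_smul, pairLaw_succ]
  induction N with
  | zero => simp [Measure.zero_le]
  | succ N ih =>
    have e : ∑ τ ∈ Finset.range (N + 1), ENNReal.ofReal M.γ ^ τ • pairLaw π τ =
        M.init.compProd π.kernel + ENNReal.ofReal M.γ •
          ((step π : M.S × M.A → Measure (M.S × M.A)) ∘ₘ
            ∑ τ ∈ Finset.range N, ENNReal.ofReal M.γ ^ τ • pairLaw π τ) := by
      rw [hb, Finset.sum_range_succ', Finset.smul_sum, add_comm]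
      simp [pairLaw_zero, pow_succ', smul_smul]
    rw [e, h]
    refine Measure.le_iff.2 fun s hs => ?_
    simp only [Measure.add_apply, Measure.smul_apply, smul_eq_mul]
    rw [Measure.bind_apply hs (Kernel.aemeasurable _), Measure.bind_apply hs (Kernel.aemeasurable _)]
    gcongr

/-- The occupation measure is the only finite solution of the flow equation of the policy. -/
lemma occupation_unique (π : M.Policy) (ρ : Measure (M.S × M.A)) [IsFiniteMeasure ρ]
    (h : ρ = M.init.compProd π.kernel +
      ENNReal.ofReal M.γ • ((step π : M.S × M.A → Measure (M.S × M.A)) ∘ₘ ρ)) :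
    occupation π = ρ := by
  apply Measure.eq_of_le_of_measure_univ_eq
  · refine Measure.le_iff.2 fun s hs => ?_
    rw [occupation, Measure.sum_apply _ hs]
    refine ENNReal.tsum_le_of_sum_range_le fun N => ?_
    simpa using sum_le_of_fixed_point π ρ h N s
  -- Evaluating the flow equation on the whole space forces total mass `1 / (1 - γ)`, so the
  -- inequality already obtained is an equality.
  · have key : ∀ ν : Measure (M.S × M.A), IsFiniteMeasure ν → ν = M.init.compProd π.kernel +
        ENNReal.ofReal M.γ • ((step π : M.S × M.A → Measure (M.S × M.A)) ∘ₘ ν) →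
        ν.real Set.univ * (1 - M.γ) = 1 := by
      intro ν hν h
      have h1 := congrArg (fun κ : Measure (M.S × M.A) => (κ Set.univ).toReal) h
      simp only [Measure.add_apply, measure_univ, Measure.smul_apply, smul_eq_mul,
        Measure.bind_apply MeasurableSet.univ (Kernel.aemeasurable _), lintegral_one] at h1
      rw [ENNReal.toReal_add (by simp) (by finiteness), ENNReal.toReal_mul,
        ENNReal.toReal_ofReal M.γ_nonneg] at h1
      simp only [ENNReal.toReal_one] at h1
      simp only [Measure.real]
      linarith
    have h1 := key _ inferInstance (occupation_eq π)
    have h2 := key ρ inferInstance h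
    have hγ : (1 - M.γ) ≠ 0 := by linarith [M.γ_lt_one]
    have h3 : (occupation π).real Set.univ = ρ.real Set.univ :=
      mul_right_cancel₀ hγ (h1.trans h2.symm)
    exact (ENNReal.toReal_eq_toReal_iff' (by finiteness) (by finiteness)).1 h3

lemma comp_step (π : M.Policy) (ρ : Measure (M.S × M.A)) [SFinite ρ] :
    (step π : M.S × M.A → Measure (M.S × M.A)) ∘ₘ ρ =
      ((M.transition : M.S × M.A → Measure M.S) ∘ₘ ρ).compProd π.kernel := by
  refine Measure.ext_of_lintegral _ fun f hf => ?_
  rw [Measure.lintegral_bind (Kernel.aemeasurable _) hf.aemeasurable,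
    Measure.lintegral_compProd hf,
    Measure.lintegral_bind (Kernel.aemeasurable _)
      (Measurable.lintegral_kernel_prod_right' hf).aemeasurable]
  congr 1
  ext x
  rw [step, Kernel.lintegral_compProd _ _ _ hf]
  rfl

lemma fst_smul_measure {X Y : Type*} [MeasurableSpace X] [MeasurableSpace Y] (c : ℝ≥0∞)
    (μ : Measure (X × Y)) : (c • μ).fst = c • μ.fst := Measure.map_smul c μ _

/-- Taking state marginals removes the policy kernel from the flow equation. What remains is affine
in the occupation measure, hence stable under mixtures. -/
lemma fst_occupation (π : M.Policy) :
    (occupation π).fst = M.init + ENNReal.ofReal M.γ •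
      ((M.transition : M.S × M.A → Measure M.S) ∘ₘ occupation π) := by
  conv_lhs => rw [occupation_eq, comp_step]
  rw [Measure.fst_add, Measure.fst_compProd, fst_smul_measure, Measure.fst_compProd]

lemma nonempty_actions (π : M.Policy) : Nonempty M.A := by
  obtain ⟨s⟩ : Nonempty M.S := nonempty_of_isProbabilityMeasure M.init
  exact nonempty_of_isProbabilityMeasure (π.kernel s)

/-- The set of occupation measures is convex. -/
lemma exists_occupation_eq_add (p q : M.Policy) (a b : ℝ≥0∞) (ha : a ≠ ∞) (hb : b ≠ ∞) (hab : a + b = 1) :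
    ∃ π : M.Policy, occupation π = a • occupation p + b • occupation q := by
  have := nonempty_actions p
  have : CompleteSpace M.A := M.isCompact_A.isClosed.completeSpace_coe
  set ρ : Measure (M.S × M.A) := a • occupation p + b • occupation q with hρ
  have : IsFiniteMeasure ρ := by
    have := Measure.smul_finite (occupation p) ha
    have := Measure.smul_finite (occupation q) hb
    infer_instance
  -- The mixing policy is the conditional law of the action given the state under the mixture;
  -- attaching it to the marginal equation restores the full flow equation.
  refine ⟨⟨ρ.condKernel, inferInstance⟩, occupation_unique _ ρ ?_⟩
  have hfst : ρ.fst = M.init + ENNReal.ofReal M.γ •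
      ((M.transition : M.S × M.A → Measure M.S) ∘ₘ ρ) := by
    rw [hρ, Measure.fst_add, fst_smul_measure, fst_smul_measure, fst_occupation, fst_occupation,
      Measure.comp_add, Measure.bind_smul, Measure.bind_smul]
    have : M.init = a • M.init + b • M.init := by rw [← add_smul, hab, one_smul]
    conv_rhs => rw [this]
    simp only [smul_add]
    rw [smul_comm a, smul_comm b]
    abel
  rw [comp_step, ← Measure.compProd_smul_left, ← Measure.compProd_add_left]
  simp only []
  rw [← hfst, ρ.disintegrate]

end

end RiskCMDP

/-! ### Separation and Lagrange multipliers. -/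

/-- Lagrange multipliers for a problem whose set of attainable value vectors is convex and which
satisfies Slater's condition. -/
lemma exists_lagrange_multiplier {P : Type*} {m : ℕ} (f : P → ℝ) (g : P → Fin m → ℝ)
    (hconv : ∀ p q : P, ∀ a b : ℝ, 0 ≤ a → 0 ≤ b → a + b = 1 →
      ∃ r : P, f r = a * f p + b * f q ∧ ∀ i, g r i = a * g p i + b * g q i)
    (p₀ : P) (hp₀ : ∀ i, 0 < g p₀ i) (V : ℝ) (hV : ∀ p, (∀ i, 0 ≤ g p i) → f p ≤ V) :
    ∃ l : Fin m → ℝ≥0, ∀ p, f p + ∑ i, (l i : ℝ) * g p i ≤ V := by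
  -- Points strictly below an attained vector `(f p - V, g p)`. Passing to strict lower sets makes
  -- `U` open, so it can be separated from `0` with no closedness assumption.
  set U : Set (ℝ × (Fin m → ℝ)) :=
    ⋃ p : P, Set.Iio (f p - V) ×ˢ Set.univ.pi fun i => Set.Iio (g p i) with hU
  have memU : ∀ x : ℝ × (Fin m → ℝ), x ∈ U ↔ ∃ p, x.1 < f p - V ∧ ∀ i, x.2 i < g p i := by
    intro x; simp [hU]
  have hopen : IsOpen U :=
    isOpen_iUnion fun p => isOpen_Iio.prod (isOpen_set_pi Set.finite_univ fun i _ => isOpen_Iio)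
  have hcv : Convex ℝ U := by
    intro x hx y hy a b ha hb hab
    obtain ⟨p, hp1, hp2⟩ := (memU x).1 hx
    obtain ⟨q, hq1, hq2⟩ := (memU y).1 hy
    obtain ⟨r, hr1, hr2⟩ := hconv p q a b ha hb hab
    have key : ∀ u v u' v' : ℝ, u < u' → v < v' → a * u + b * v < a * u' + b * v' := by
      intro u v u' v' h1 h2
      rcases ha.eq_or_lt with rfl | ha'
      · have : b = 1 := by linarith
        subst this; linarith
      · have := mul_lt_mul_of_pos_left h1 ha'
        have := mul_le_mul_of_nonneg_left h2.le hb
        linarith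
    refine (memU _).2 ⟨r, ?_, fun i => ?_⟩
    · have := key _ _ _ _ hp1 hq1
      simp only [Prod.fst_add, Prod.smul_fst, smul_eq_mul]
      have e : V = a * V + b * V := by rw [← add_mul, hab, one_mul]
      rw [hr1]; linarith
    · rw [hr2]
      exact key _ _ _ _ (hp2 i) (hq2 i)
  have h0 : (0 : ℝ × (Fin m → ℝ)) ∉ U := by
    rw [memU]
    rintro ⟨p, h1, h2⟩
    have := hV p fun i => (h2 i).le
    simp only [Prod.fst_zero] at h1
    linarith
  obtain ⟨φ, hφ⟩ := geometric_hahn_banach_open_point hcv hopen h0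
  rw [map_zero] at hφ
  set α := φ (1, 0) with hα
  set β : Fin m → ℝ := fun i => φ (0, Pi.single i 1) with hβ
  have hφe : ∀ y z, φ (y, z) = y * α + ∑ i, z i * β i := by
    intro y z
    have : (y, z) = y • ((1 : ℝ), (0 : Fin m → ℝ)) +
        ∑ i, z i • ((0 : ℝ), (Pi.single i 1 : Fin m → ℝ)) := by
      ext j
      · simp [Prod.fst_sum]
      · simp [Prod.snd_sum, Finset.sum_apply, Pi.single_apply]
    rw [this, map_add, map_smul, map_sum]
    simp only [map_smul, smul_eq_mul, hα, hβ]
  have hneg : ∀ (p : P) (y : ℝ) (z : Fin m → ℝ), y < f p - V → (∀ i, z i < g p i) → y * α + ∑ i, z i * β i < 0 := by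
    intro p y z h1 h2
    rw [← hφe]
    exact hφ _ ((memU _).2 ⟨p, h1, h2⟩)
  -- `U` is unbounded in every negative coordinate direction, so a functional negative on `U` must
  -- have nonnegative coefficients.
  have ray : ∀ c s : ℝ, (∀ t, 0 ≤ t → c - t * s < 0) → 0 ≤ s := by
    intro c s h
    by_contra hs
    push Not at hs
    have := h (|c| / (-s)) (by apply div_nonneg (abs_nonneg c); linarith)
    have e : |c| / (-s) * s = -|c| := by rw [div_neg, neg_mul, div_mul_cancel₀ _ hs.ne]
    rw [e] at this
    linarith [neg_abs_le c]
  have hα0 : 0 ≤ α := by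
    refine ray ((f p₀ - V - 1) * α) α fun t ht => ?_
    have := hneg p₀ (f p₀ - V - 1 - t) 0 (by linarith) (by simpa using hp₀)
    simp only [Pi.zero_apply, zero_mul, Finset.sum_const_zero] at this
    linarith
  have hβ0 : ∀ i, 0 ≤ β i := by
    intro j
    refine ray ((f p₀ - V - 1) * α) (β j) fun t ht => ?_
    have := hneg p₀ (f p₀ - V - 1) (-(t • Pi.single j 1)) (by linarith) (fun i => by
      have : 0 ≤ t * (Pi.single j 1 : Fin m → ℝ) i :=
        mul_nonneg ht (by rw [Pi.single_apply]; split_ifs <;> norm_num)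
      have := hp₀ i
      simp only [Pi.neg_apply, Pi.smul_apply, smul_eq_mul]; linarith)
    simpa [Pi.single_apply, sub_eq_add_neg] using this
  -- Attained vectors lie in the closure of `U`: lower all coordinates by `δ` and let `δ` shrink.
  have hle : ∀ p, (f p - V) * α + ∑ i, g p i * β i ≤ 0 := by
    intro p
    refine le_of_forall_pos_lt_add fun e he => ?_
    set C := α + ∑ i, β i
    have hC : 0 ≤ C := add_nonneg hα0 (Finset.sum_nonneg fun i _ => hβ0 i)
    set δ := e / (C + 1)
    have hδ : 0 < δ := by positivity
    have := hneg p (f p - V - δ) (fun i => g p i - δ) (by linarith) (fun i => by linarith)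
    simp only [sub_mul, Finset.sum_sub_distrib, ← Finset.mul_sum] at this
    have h2 : δ * C < e := by
      have : δ * (C + 1) = e := by simp only [δ]; field_simp
      linarith
    have h3 : δ * C = δ * α + δ * ∑ i, β i := mul_add _ _ _
    rw [sub_mul]
    linarith
  -- Slater's condition enters here: if `α = 0`, positivity of `g p₀` forces `β = 0`, so the
  -- functional vanishes, yet it is negative on `U`.
  have hαpos : 0 < α := by
    refine lt_of_le_of_ne hα0 fun hz => ?_
    have hs := hle p₀
    rw [← hz, mul_zero, zero_add] at hs
    have hb : ∀ i, β i = 0 := by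
      intro i
      have hnn : ∀ i ∈ Finset.univ, 0 ≤ g p₀ i * β i := fun i _ => mul_nonneg (hp₀ i).le (hβ0 i)
      have := (Finset.sum_eq_zero_iff_of_nonneg hnn).1
        (le_antisymm hs (Finset.sum_nonneg hnn)) i (Finset.mem_univ i)
      exact (mul_eq_zero.1 this).resolve_left (hp₀ i).ne'
    have := hneg p₀ (f p₀ - V - 1) 0 (by linarith) (by simpa using hp₀)
    rw [← hz] at this
    simp [hb] at this
  refine ⟨fun i => ⟨β i / α, div_nonneg (hβ0 i) hαpos.le⟩, fun p => ?_⟩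
  have h := hle p
  have e : ∑ i, β i / α * g p i = (∑ i, g p i * β i) / α := by
    rw [Finset.sum_div]
    exact Finset.sum_congr rfl fun i _ => by ring
  change f p + ∑ i, β i / α * g p i ≤ V
  rw [e]
  have : (∑ i, g p i * β i) / α ≤ V - f p := by
    rw [div_le_iff₀ hαpos]; linarith
  linarith

/-! ### Integrals and total variation. -/

/-- The difference of the integrals of a bounded function is controlled by total variation. -/
lemma abs_integral_sub_integral_le_totalVariation {X : Type*} [MeasurableSpace X]
    (μ ν : Measure X) [IsFiniteMeasure μ] [IsFiniteMeasure ν] {f : X → ℝ} (hf : Measurable f)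
    {C ε : ℝ} (hC : ∀ x, |f x| ≤ C) (hC0 : 0 ≤ C) (hε : 0 ≤ ε)
    (h : (μ.toSignedMeasure - ν.toSignedMeasure).totalVariation Set.univ ≤ ENNReal.ofReal ε) :
    |∫ x, f x ∂μ - ∫ x, f x ∂ν| ≤ C * ε := by
  set j := (μ.toSignedMeasure - ν.toSignedMeasure).toJordanDecomposition with hj
  have hint : ∀ κ : Measure X, IsFiniteMeasure κ → Integrable f κ := fun κ _ =>
    Integrable.of_bound hf.aestronglyMeasurable C (Filter.Eventually.of_forall hC)
  -- The Jordan decomposition, rearranged as an identity of positive measures so that ordinary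
  -- integrals apply.
  have he : μ + j.negPart = ν + j.posPart := by
    rw [← Measure.toSignedMeasure_eq_toSignedMeasure_iff, Measure.toSignedMeasure_add,
      Measure.toSignedMeasure_add]
    have := SignedMeasure.toSignedMeasure_toJordanDecomposition
      (μ.toSignedMeasure - ν.toSignedMeasure)
    rw [← hj, JordanDecomposition.toSignedMeasure, sub_eq_sub_iff_add_eq_add] at this
    rw [add_comm ν.toSignedMeasure, this, add_comm]
  have hi := congrArg (fun κ => ∫ x, f x ∂κ) he
  rw [integral_add_measure (hint _ inferInstance) (hint _ inferInstance),
    integral_add_measure (hint _ inferInstance) (hint _ inferInstance)] at hi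
  have hb : ∀ κ : Measure X, IsFiniteMeasure κ → |∫ x, f x ∂κ| ≤ C * κ.real Set.univ := fun κ _ =>
    norm_integral_le_of_norm_le_const (f := f) (Filter.Eventually.of_forall hC)
  have h1 := hb j.posPart inferInstance
  have h2 := hb j.negPart inferInstance
  have h3 : j.posPart.real Set.univ + j.negPart.real Set.univ ≤ ε := by
    have := ENNReal.toReal_mono ENNReal.ofReal_ne_top h
    rwa [ENNReal.toReal_ofReal hε, SignedMeasure.totalVariation, ← hj, Measure.add_apply,
      ENNReal.toReal_add (by finiteness) (by finiteness)] at this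
  have h4 := mul_le_mul_of_nonneg_left h3 hC0
  rw [show ∫ x, f x ∂μ - ∫ x, f x ∂ν = ∫ x, f x ∂j.posPart - ∫ x, f x ∂j.negPart by linarith]
  exact (abs_sub _ _).trans (by linarith)

/-! ### Values: linearity in the occupation measure and Lipschitz dependence on the policy. -/

namespace RiskCMDP

variable {n d m : ℕ} {M : RiskCMDP n d m}

lemma measurable_modReward (i : Fin (m + 1)) (u : ℝ) : Measurable (modReward M i u) := by
  have := M.measurable_r i
  unfold modReward
  fun_prop

lemma abs_modReward_le {B R u : ℝ} {i : Fin (m + 1)} {x : M.S × M.A} (hB : |M.r i x| ≤ B)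
    (hu : |u| ≤ R) : |modReward M i u x| ≤ R + 1 / M.β * (R + B) := by
  have hβ : 0 ≤ 1 / M.β := one_div_nonneg.2 M.β_pos.le
  have h1 : |max (u - M.r i x) 0| ≤ R + B := by
    rw [abs_of_nonneg (le_max_right _ _)]
    have h0 : 0 ≤ R + B := add_nonneg ((abs_nonneg _).trans hu) ((abs_nonneg _).trans hB)
    have := abs_le.1 hB
    have := abs_le.1 hu
    exact max_le (by linarith) h0
  have h2 := mul_le_mul_of_nonneg_left h1 hβ
  unfold modReward
  refine (abs_sub _ _).trans ?_
  rw [abs_mul, abs_of_nonneg hβ]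
  linarith

lemma exists_abs_modReward_le (i : Fin (m + 1)) (u : ℝ) :
    ∃ C, ∀ x, |modReward M i u x| ≤ C := by
  obtain ⟨B, hB⟩ := M.bounded_r
  exact ⟨_, fun x => abs_modReward_le (hB i x) le_rfl⟩

lemma integrable_of_bounded {X : Type*} [MeasurableSpace X] (μ : Measure X) [IsFiniteMeasure μ]
    {f : X → ℝ} (hf : Measurable f) {C : ℝ} (hC : ∀ x, |f x| ≤ C) : Integrable f μ :=
  Integrable.of_bound hf.aestronglyMeasurable C (Filter.Eventually.of_forall hC)

lemma hasSum_integral_pairLaw (π : M.Policy) {f : M.S × M.A → ℝ} (hf : Measurable f) {C : ℝ}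
    (hC : ∀ x, |f x| ≤ C) :
    HasSum (fun τ : ℕ => M.γ ^ τ * ∫ x, f x ∂pairLaw π τ) (∫ x, f x ∂occupation π) := by
  have h := hasSum_integral_measure (μ := fun τ : ℕ => ENNReal.ofReal M.γ ^ τ • pairLaw π τ)
    (f := f) (integrable_of_bounded (occupation π) hf hC)
  simp only [integral_smul_measure, ENNReal.toReal_pow, ENNReal.toReal_ofReal M.γ_nonneg,
    smul_eq_mul] at h
  exact h

lemma value_eq_integral_occupation (π : M.Policy) (i : Fin (m + 1)) (u : ℝ) :
    value π i u = ∫ x, modReward M i u x ∂occupation π := by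
  obtain ⟨C, hC⟩ := exists_abs_modReward_le (M := M) i u
  have hf := measurable_modReward (M := M) i u
  have hint : ∀ τ : ℕ, Integrable (fun ω => M.γ ^ τ * modReward M i u (ω τ)) (pathMeasure π) :=
    fun τ => (integrable_of_bounded (C := C) (f := fun ω : ℕ → M.S × M.A => modReward M i u (ω τ)) _
      (hf.comp (measurable_pi_apply τ)) fun ω => hC (ω τ)).const_mul _
  rw [← (hasSum_integral_pairLaw π hf hC).tsum_eq, value,
    ← integral_tsum_of_summable_integral_norm hint]
  · refine tsum_congr fun τ => ?_
    rw [integral_const_mul, pairLaw,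
      integral_map (measurable_pi_apply τ).aemeasurable hf.aestronglyMeasurable]
  · refine Summable.of_nonneg_of_le (fun τ => integral_nonneg fun ω => norm_nonneg _) (fun τ => ?_)
      ((summable_geometric_of_lt_one M.γ_nonneg M.γ_lt_one).mul_right C)
    have h := integral_mono (hint τ).norm (integrable_const (M.γ ^ τ * C)) fun ω => by
      change ‖M.γ ^ τ * modReward M i u (ω τ)‖ ≤ M.γ ^ τ * C
      rw [norm_mul, Real.norm_of_nonneg (pow_nonneg M.γ_nonneg τ)]
      exact mul_le_mul_of_nonneg_left (hC _) (pow_nonneg M.γ_nonneg τ)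
    simpa using h

lemma abs_value_le (π : M.Policy) {i : Fin (m + 1)} {u C : ℝ}
    (hC : ∀ x, |modReward M i u x| ≤ C) : |value π i u| ≤ C * (1 - M.γ)⁻¹ := by
  rw [value_eq_integral_occupation]
  refine (norm_integral_le_of_norm_le_const (f := modReward M i u) (Filter.Eventually.of_forall hC)).trans_eq ?_
  rw [Measure.real, occupation_univ, ENNReal.toReal_inv,
    ENNReal.toReal_sub_of_le (ENNReal.ofReal_le_one.2 M.γ_lt_one.le) ENNReal.one_ne_top,
    ENNReal.toReal_one, ENNReal.toReal_ofReal M.γ_nonneg]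

/-- A single `π` serves all `i` and `u`, because it realizes the mixture of occupation measures;
this gives convexity of the set of value vectors. -/
lemma exists_value_eq_add (p q : M.Policy) {a b : ℝ} (ha : 0 ≤ a) (hb : 0 ≤ b) (hab : a + b = 1) :
    ∃ π : M.Policy, ∀ i u, value π i u = a * value p i u + b * value q i u := by
  obtain ⟨π, hπ⟩ := exists_occupation_eq_add p q (ENNReal.ofReal a) (ENNReal.ofReal b)
    ENNReal.ofReal_ne_top ENNReal.ofReal_ne_top (by
      rw [← ENNReal.ofReal_add ha hb, hab, ENNReal.ofReal_one])
  refine ⟨π, fun i u => ?_⟩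
  obtain ⟨C, hC⟩ := exists_abs_modReward_le (M := M) i u
  have hf := measurable_modReward (M := M) i u
  simp only [value_eq_integral_occupation]
  rw [hπ, integral_add_measure, integral_smul_measure, integral_smul_measure,
    ENNReal.toReal_ofReal ha, ENNReal.toReal_ofReal hb, smul_eq_mul, smul_eq_mul]
  · exact (integrable_of_bounded _ hf hC).smul_measure ENNReal.ofReal_ne_top
  · exact (integrable_of_bounded _ hf hC).smul_measure ENNReal.ofReal_ne_top

lemma abs_integral_le_of_bounded {X : Type*} [MeasurableSpace X] (μ : Measure X)
    [IsProbabilityMeasure μ] {f : X → ℝ} {C : ℝ} (hC : ∀ x, |f x| ≤ C) : |∫ x, f x ∂μ| ≤ C := by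
  have := norm_integral_le_of_norm_le_const (μ := μ) (f := f) (Filter.Eventually.of_forall hC)
  simpa using this

/-- Policies that are uniformly close in total variation induce close integrals at one state
distribution. -/
lemma abs_integral_compProd_sub_le (ν : Measure M.S) [IsProbabilityMeasure ν] {p q : M.Policy}
    {ε : ℝ} (hε : 0 ≤ ε)
    (h : ∀ s : M.S, ((p.kernel s).toSignedMeasure - (q.kernel s).toSignedMeasure).totalVariation
      Set.univ ≤ ENNReal.ofReal ε)
    {f : M.S × M.A → ℝ} (hf : Measurable f) {C : ℝ} (hC0 : 0 ≤ C) (hC : ∀ x, |f x| ≤ C) :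
    |∫ x, f x ∂(ν.compProd p.kernel) - ∫ x, f x ∂(ν.compProd q.kernel)| ≤ C * ε := by
  have hm : ∀ κ : Kernel M.S M.A, IsMarkovKernel κ →
      Integrable (fun s => ∫ a, f (s, a) ∂κ s) ν := fun κ _ =>
    integrable_of_bounded ν (hf.stronglyMeasurable.integral_kernel_prod_right').measurable
      fun s => abs_integral_le_of_bounded (κ s) fun a => hC (s, a)
  rw [Measure.integral_compProd (integrable_of_bounded _ hf hC),
    Measure.integral_compProd (integrable_of_bounded _ hf hC),
    ← integral_sub (hm _ inferInstance) (hm _ inferInstance)]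
  refine abs_integral_le_of_bounded ν fun s => ?_
  exact abs_integral_sub_integral_le_totalVariation _ _ (hf.comp measurable_prodMk_left)
    (fun a => hC (s, a)) hC0 hε (h s)

/-- Each action draw costs at most `C * ε`, and time `τ` involves `τ + 1` draws. The bound is for
all `f` at once, since the induction applies it to the one-step average of `f` under `p`. -/
lemma abs_integral_pairLaw_sub_le {p q : M.Policy} {ε : ℝ} (hε : 0 ≤ ε)
    (h : ∀ s : M.S, ((p.kernel s).toSignedMeasure - (q.kernel s).toSignedMeasure).totalVariation
      Set.univ ≤ ENNReal.ofReal ε) {C : ℝ} (hC0 : 0 ≤ C) (τ : ℕ) :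
    ∀ f : M.S × M.A → ℝ, Measurable f → (∀ x, |f x| ≤ C) →
      |∫ x, f x ∂pairLaw p τ - ∫ x, f x ∂pairLaw q τ| ≤ (τ + 1) * (C * ε) := by
  induction τ with
  | zero =>
    intro f hf hC
    simpa [pairLaw_zero] using abs_integral_compProd_sub_le M.init hε h hf hC0 hC
  | succ τ ih =>
    intro f hf hC
    have hg : Measurable fun x => ∫ a, f a ∂step p x :=
      hf.stronglyMeasurable.integral_kernel.measurable
    have e : ∀ ρ : Measure (M.S × M.A), IsProbabilityMeasure ρ → ∀ π : M.Policy,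
        ∫ x, f x ∂((step π : M.S × M.A → Measure (M.S × M.A)) ∘ₘ ρ) =
          ∫ x, ∫ a, f a ∂step π x ∂ρ := by
      intro ρ _ π
      rw [Measure.comp_eq_comp_const_apply, Kernel.integral_comp (integrable_of_bounded _ hf hC),
        Kernel.const_apply]
    have h1 := ih _ hg fun x => abs_integral_le_of_bounded (step p x) hC
    have h2 := abs_integral_compProd_sub_le
      ((M.transition : M.S × M.A → Measure M.S) ∘ₘ pairLaw q τ) hε h hf hC0 hC
    rw [← comp_step, ← comp_step, e _ inferInstance, e _ inferInstance] at h2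
    rw [pairLaw_succ, pairLaw_succ, e _ inferInstance, e _ inferInstance]
    refine (abs_sub_le _ _ _).trans ((add_le_add h1 h2).trans_eq ?_)
    push_cast
    ring

/-- The value functions are Lipschitz in the policy with respect to total variation. -/
lemma abs_value_sub_le {p q : M.Policy} {ε : ℝ} (hε : 0 ≤ ε)
    (h : ∀ s : M.S, ((p.kernel s).toSignedMeasure - (q.kernel s).toSignedMeasure).totalVariation
      Set.univ ≤ ENNReal.ofReal ε) {i : Fin (m + 1)} {u C : ℝ} (hC0 : 0 ≤ C)
    (hC : ∀ x, |modReward M i u x| ≤ C) :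
    |value p i u - value q i u| ≤ C * (∑' τ : ℕ, M.γ ^ τ * (τ + 1)) * ε := by
  have hf := measurable_modReward (M := M) i u
  have hs : Summable fun τ : ℕ => M.γ ^ τ * ((τ : ℝ) + 1) := by
    have hγ : ‖M.γ‖ < 1 := by rw [Real.norm_of_nonneg M.γ_nonneg]; exact M.γ_lt_one
    have h1 := summable_pow_mul_geometric_of_norm_lt_one 1 hγ
    refine (h1.add (summable_geometric_of_norm_lt_one hγ)).congr fun τ => ?_
    simp; ring
  have hp := hasSum_integral_pairLaw p hf hC
  have hq := hasSum_integral_pairLaw q hf hC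
  rw [value_eq_integral_occupation, value_eq_integral_occupation,
    ← (hp.sub hq).tsum_eq]
  have hle : ∀ τ : ℕ, ‖M.γ ^ τ * ∫ x, modReward M i u x ∂pairLaw p τ -
      M.γ ^ τ * ∫ x, modReward M i u x ∂pairLaw q τ‖ ≤ M.γ ^ τ * (τ + 1) * (C * ε) := by
    intro τ
    rw [← mul_sub, norm_mul, Real.norm_of_nonneg (pow_nonneg M.γ_nonneg τ), mul_assoc]
    exact mul_le_mul_of_nonneg_left (abs_integral_pairLaw_sub_le hε h hC0 τ _ hf hC)
      (pow_nonneg M.γ_nonneg τ)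
  refine (tsum_of_norm_bounded (hs.mul_right (C * ε)).hasSum hle).trans_eq ?_
  rw [tsum_mul_right]
  ring

end RiskCMDP

/-! ### Lagrangian duality at fixed `t` and the approximation estimate. -/

namespace RiskCMDP

variable {n d m : ℕ} {M : RiskCMDP n d m}

lemma value_le_lagrangian {π : M.Policy} {t : Fin (m + 1) → ℝ} (h : Feasible π t)
    (l : Fin m → ℝ≥0) : value π 0 (t 0) ≤ lagrangian π t l :=
  le_add_of_nonneg_right <| Finset.sum_nonneg fun i _ =>
    mul_nonneg (l i).2 (sub_nonneg.2 (h i))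

lemma iInf_lagrangian_of_feasible {π : M.Policy} {t : Fin (m + 1) → ℝ} (h : Feasible π t) :
    ⨅ l : Fin m → ℝ≥0, ((lagrangian π t l : ℝ) : EReal) = (value π 0 (t 0) : ℝ) := by
  refine le_antisymm ((iInf_le _ 0).trans_eq ?_)
    (le_iInf fun l => EReal.coe_le_coe_iff.2 (value_le_lagrangian h l))
  simp [lagrangian]

lemma iInf_lagrangian_of_not_feasible {π : M.Policy} {t : Fin (m + 1) → ℝ} (h : ¬ Feasible π t) :
    ⨅ l : Fin m → ℝ≥0, ((lagrangian π t l : ℝ) : EReal) = ⊥ := by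
  simp only [Feasible, not_forall, not_le] at h
  obtain ⟨j, hj⟩ := h
  refine EReal.eq_bot_iff_forall_lt _ |>.2 fun y => ?_
  have hd : 0 < M.c j - value π j.succ (t j.succ) := sub_pos.2 hj
  -- Weight on the violated constraint alone, large enough to push the Lagrangian below `y`.
  obtain ⟨k, hk⟩ : ∃ k : ℝ≥0,
      (k : ℝ) = (|value π 0 (t 0) - y| + 1) / (M.c j - value π j.succ (t j.succ)) :=
    ⟨⟨_, by positivity⟩, rfl⟩
  refine (iInf_le _ (Pi.single j k)).trans_lt (EReal.coe_lt_coe_iff.2 ?_)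
  have e : ∑ i : Fin m, ((Pi.single j k : Fin m → ℝ≥0) i : ℝ) *
      (value π i.succ (t i.succ) - M.c i) = k * (value π j.succ (t j.succ) - M.c j) := by
    rw [Finset.sum_eq_single j (fun i _ hi => by simp [Pi.single_eq_of_ne hi]) (by simp),
      Pi.single_eq_same]
  have e2 : k * (M.c j - value π j.succ (t j.succ)) = |value π 0 (t 0) - y| + 1 := by
    rw [hk, div_mul_cancel₀ _ hd.ne']
  rw [lagrangian, e]
  linarith [le_abs_self (value π 0 (t 0) - y)]

lemma primal_eq_fixedValue (t : Fin (m + 1) → ℝ) : M.primal t = M.fixedValue t := by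
  refine iSup_congr fun π => ?_
  by_cases h : Feasible π t
  · rw [iInf_lagrangian_of_feasible h, iSup_pos h]
  · rw [iInf_lagrangian_of_not_feasible h, iSup_neg h]

/-- Strong duality at a parameter satisfying Slater's condition. -/
lemma exists_forall_lagrangian_le {t : Fin (m + 1) → ℝ} (hs : M.Slater t) {V : ℝ}
    (hV : ∀ π : M.Policy, Feasible π t → value π 0 (t 0) ≤ V) :
    ∃ l : Fin m → ℝ≥0, ∀ π : M.Policy, lagrangian π t l ≤ V := by
  obtain ⟨π₀, h₀⟩ := hs
  refine exists_lagrange_multiplier (fun π : M.Policy => value π 0 (t 0))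
    (fun π i => value π i.succ (t i.succ) - M.c i) (fun p q a b ha hb hab => ?_) π₀
    (fun i => sub_pos.2 (h₀ i)) V (fun π h => hV π fun i => sub_nonneg.1 (h i))
  obtain ⟨r, hr⟩ := exists_value_eq_add p q ha hb hab
  refine ⟨r, hr _ _, fun i => ?_⟩
  have e : M.c i = a * M.c i + b * M.c i := by rw [← add_mul, hab, one_mul]
  change value r i.succ (t i.succ) - M.c i = _
  rw [hr]
  linarith

lemma fixedValue_ne_bot {t : Fin (m + 1) → ℝ} (hs : M.Slater t) : M.fixedValue t ≠ ⊥ := by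
  obtain ⟨π, h⟩ := hs
  have : ((value π 0 (t 0) : ℝ) : EReal) ≤ M.fixedValue t :=
    le_iSup₂_of_le (f := fun (π : M.Policy) (_ : Feasible π t) => ((value π 0 (t 0) : ℝ) : EReal))
      π (fun i => (h i).le) le_rfl
  exact ((EReal.bot_lt_coe _).trans_le this).ne'

lemma fixedValue_ne_top (t : Fin (m + 1) → ℝ) : M.fixedValue t ≠ ⊤ := by
  obtain ⟨C, hC⟩ := exists_abs_modReward_le (M := M) 0 (t 0)
  have : M.fixedValue t ≤ ((C * (1 - M.γ)⁻¹ : ℝ) : EReal) :=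
    iSup₂_le fun π _ => EReal.coe_le_coe_iff.2 ((le_abs_self _).trans (abs_value_le π hC))
  exact (this.trans_lt (EReal.coe_lt_top _)).ne

/-- The parametrized dual value never exceeds the optimal value. -/
lemma paramDual_le_primal {T I : Set (Fin (m + 1) → ℝ)} {tstar : Fin (m + 1) → ℝ}
    (hCQ : M.ConstraintQualification T I tstar) {Θ : Type*} (pol : Θ → M.Policy) :
    paramDual pol I ≤ M.primal tstar := by
  rw [primal_eq_fixedValue]
  refine iSup₂_le fun t ht => ?_
  have hV := EReal.coe_toReal (fixedValue_ne_top (M := M) tstar)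
    (fixedValue_ne_bot (hCQ.slater _ hCQ.mem_I))
  rw [← hV]
  -- The multiplier is taken at `t` but against the optimal value at `tstar`, which bounds the
  -- values at `t` by maximality.
  obtain ⟨l, hl⟩ := exists_forall_lagrangian_le (hCQ.slater t ht)
    (V := (M.fixedValue tstar).toReal) fun π h => by
      rw [← EReal.coe_le_coe_iff, hV]
      exact (le_iSup₂_of_le (f := fun (π : M.Policy) (_ : Feasible π t) =>
        ((value π 0 (t 0) : ℝ) : EReal)) π h le_rfl).trans (hCQ.isMax t (hCQ.subset ht))
  exact (iInf_le _ l).trans (iSup_le fun θ => EReal.coe_le_coe_iff.2 (hl _))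

lemma primal_eq_iSup {T I : Set (Fin (m + 1) → ℝ)} {tstar : Fin (m + 1) → ℝ}
    (hCQ : M.ConstraintQualification T I tstar) :
    M.primal tstar = ⨆ t ∈ I, M.primal t := by
  refine le_antisymm (le_iSup₂_of_le (f := fun t (_ : t ∈ I) => M.primal t) tstar hCQ.mem_I le_rfl)
    (iSup₂_le fun t ht => ?_)
  rw [primal_eq_fixedValue, primal_eq_fixedValue]
  exact hCQ.isMax t (hCQ.subset ht)

lemma exists_uniform_abs_modReward_le {I : Set (Fin (m + 1) → ℝ)} (hI : IsCompact I) :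
    ∃ C, 0 ≤ C ∧ ∀ t ∈ I, ∀ i x, |modReward M i (t i) x| ≤ C := by
  obtain ⟨B, hB⟩ := M.bounded_r
  obtain ⟨R, hR⟩ := hI.isBounded.exists_norm_le
  refine ⟨max (R + 1 / M.β * (R + B)) 0, le_max_right _ _, fun t ht i x => ?_⟩
  exact (abs_modReward_le (hB i x) ((norm_le_pi_norm t i).trans (hR t ht))).trans (le_max_left _ _)

lemma exists_slater_margin {t : Fin (m + 1) → ℝ} (hs : M.Slater t) :
    ∃ π : M.Policy, ∃ δ : ℝ, 0 < δ ∧ ∀ i : Fin m, δ ≤ value π i.succ (t i.succ) - M.c i := by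
  obtain ⟨π, hπ⟩ := hs
  obtain ⟨δ, hδ, h⟩ := Pi.exists_forall_pos_add_lt (x := M.c)
    (y := fun i => value π i.succ (t i.succ)) hπ
  exact ⟨π, δ, hδ, fun i => by linarith [h i]⟩

lemma lagrangian_sub_le {p q : M.Policy} {t : Fin (m + 1) → ℝ} {η : ℝ}
    (h : ∀ i, |value p i (t i) - value q i (t i)| ≤ η) (l : Fin m → ℝ≥0) :
    lagrangian p t l - (1 + ∑ i, (l i : ℝ)) * η ≤ lagrangian q t l := by
  have h0 := (abs_le.1 (h 0)).2
  have h1 : ∑ i : Fin m, (l i : ℝ) * (value p i.succ (t i.succ) - M.c i) -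
      (∑ i, (l i : ℝ)) * η ≤ ∑ i : Fin m, (l i : ℝ) * (value q i.succ (t i.succ) - M.c i) := by
    rw [Finset.sum_mul, ← Finset.sum_sub_distrib]
    refine Finset.sum_le_sum fun i _ => ?_
    rw [← mul_sub]
    exact mul_le_mul_of_nonneg_left (by linarith [(abs_le.1 (h i.succ)).2]) (l i).2
  unfold lagrangian
  linarith

/-- If a strictly feasible policy stays strictly feasible up to the approximation error `η`, then
the Lagrangian over an approximating family dominates the feasible values up to a multiple
of `η`. -/
lemma exists_lagrangian_ge {Θ : Type*} {pol : Θ → M.Policy} {t : Fin (m + 1) → ℝ} {K δ η : ℝ}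
    (hK : 0 ≤ K) (hδ : 0 < δ) (hη : 0 ≤ η) (hηδ : η ≤ δ / 2)
    (hval : ∀ (π : M.Policy) i, |value π i (t i)| ≤ K)
    {π₀ : M.Policy} (h₀ : ∀ i : Fin m, δ ≤ value π₀ i.succ (t i.succ) - M.c i)
    (happ : ∀ π : M.Policy, ∃ θ, ∀ i, |value π i (t i) - value (pol θ) i (t i)| ≤ η)
    {π : M.Policy} (hπ : Feasible π t) (l : Fin m → ℝ≥0) :
    ∃ θ, value π 0 (t 0) - (1 + (4 * K + δ) / δ) * η ≤ lagrangian (pol θ) t l := by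
  have hl : 0 ≤ ∑ i, (l i : ℝ) := Finset.sum_nonneg fun i _ => (l i).2
  have hΛ : 0 ≤ (4 * K + δ) / δ := by positivity
  -- At this threshold, half of the margin term `δ * ∑ λ` absorbs the approximation error in the
  -- constraints, and the other half is at least `2 * K`, which lifts the objective from `-K` to
  -- `K`.
  rcases le_total (∑ i, (l i : ℝ)) ((4 * K + δ) / δ) with hle | hge
  · obtain ⟨θ, hθ⟩ := happ π
    refine ⟨θ, le_trans ?_ (lagrangian_sub_le hθ l)⟩
    have h1 := value_le_lagrangian hπ l
    have h2 := mul_le_mul_of_nonneg_right hle hη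
    linarith
  · obtain ⟨θ, hθ⟩ := happ π₀
    refine ⟨θ, le_trans ?_ (lagrangian_sub_le hθ l)⟩
    have h1 : (∑ i, (l i : ℝ)) * δ ≤
        ∑ i : Fin m, (l i : ℝ) * (value π₀ i.succ (t i.succ) - M.c i) := by
      rw [Finset.sum_mul]
      exact Finset.sum_le_sum fun i _ => mul_le_mul_of_nonneg_left (h₀ i) (l i).2
    have h2 := (abs_le.1 (hval π₀ 0)).1
    have h3 := (abs_le.1 (hval π 0)).2
    have h4 := mul_le_mul_of_nonneg_left hηδ hl
    have h5 : 4 * K + δ ≤ (∑ i, (l i : ℝ)) * δ := (div_le_iff₀ hδ).1 hge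
    have h6 := mul_nonneg hΛ hη
    unfold lagrangian
    linarith

end RiskCMDP

/-! ### The main theorem. -/

/-- Almost-zero duality gap. The constants `G` and `ε₀` depend on the problem, `I` and `tstar`, but
neither on `ε` nor on the parametrization. -/
theorem theorem1 {n d m : ℕ} (M : RiskCMDP n d m) (T I : Set (Fin (m + 1) → ℝ))
    (tstar : Fin (m + 1) → ℝ) (hT : M.IsRegion T) (hCQ : M.ConstraintQualification T I tstar) :
    M.primal tstar = ⨆ t ∈ I, M.primal t ∧
    ∃ G : ℝ, 0 ≤ G ∧ ∃ ε₀ : ℝ, 0 < ε₀ ∧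
      ∀ (p : ℕ) (Θ : Set (EuclideanSpace ℝ (Fin p))) (pol : Θ → M.Policy) (ε : ℝ),
        IsCompact Θ → 0 < ε → RiskCMDP.IsUniversal pol ε →
        (∃ θ : Θ, ∃ t ∈ T, RiskCMDP.Feasible (pol θ) t) →
          RiskCMDP.paramDual pol I ≤ M.primal tstar ∧
          ((ε ≤ ε₀ ∨ ∃ θ : Θ, ∃ t ∈ I, RiskCMDP.Feasible (pol θ) t) →
            M.primal tstar - ((G * (ε / (1 - M.γ)) : ℝ) : EReal) ≤ RiskCMDP.paramDual pol I) := by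
  refine ⟨RiskCMDP.primal_eq_iSup hCQ, ?_⟩
  obtain ⟨C, hC0, hC⟩ := RiskCMDP.exists_uniform_abs_modReward_le (M := M) hCQ.isCompact
  obtain ⟨π₀, δ, hδ, hπ₀⟩ := RiskCMDP.exists_slater_margin (hCQ.slater _ hCQ.mem_I)
  have hγ : 0 < 1 - M.γ := sub_pos.2 M.γ_lt_one
  set K := C * (1 - M.γ)⁻¹
  have hK : 0 ≤ K := by positivity
  set D := C * ∑' τ : ℕ, M.γ ^ τ * ((τ : ℝ) + 1)
  have hD : 0 ≤ D := mul_nonneg hC0 <| tsum_nonneg fun τ =>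
    mul_nonneg (pow_nonneg M.γ_nonneg τ) (by positivity)
  -- Chosen so that `ε ≤ ε₀` gives `D * ε ≤ δ / 2`; the `+ 1` covers `D = 0`.
  set ε₀ := δ / (2 * (D + 1))
  have hε₀ : 0 < ε₀ := by positivity
  set G₁ := (1 + (4 * K + δ) / δ) * D
  have hG₁ : 0 ≤ G₁ := by positivity
  -- `G₁` handles small `ε` and `2 * K / ε₀` large `ε`; the factor `1 - γ` cancels the denominator
  -- in the statement.
  refine ⟨(1 - M.γ) * (G₁ + 2 * K / ε₀), by positivity, ε₀, hε₀,
    fun p Θ pol ε _ hε huniv _ => ⟨RiskCMDP.paramDual_le_primal hCQ pol, fun hor => ?_⟩⟩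
  have hc : (1 - M.γ) * (G₁ + 2 * K / ε₀) * (ε / (1 - M.γ)) = G₁ * ε + 2 * K / ε₀ * ε := by
    field_simp
  have h2K : 0 ≤ 2 * K / ε₀ * ε := by positivity
  have hG₁ε : 0 ≤ G₁ * ε := by positivity
  rw [hc, RiskCMDP.primal_eq_fixedValue,
    EReal.sub_le_iff_le_add (Or.inl (EReal.coe_ne_bot _)) (Or.inl (EReal.coe_ne_top _))]
  refine iSup₂_le fun π hπ => ?_
  rw [← EReal.sub_le_iff_le_add (Or.inl (EReal.coe_ne_bot _)) (Or.inl (EReal.coe_ne_top _)),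
    ← EReal.coe_sub]
  have hval : ∀ t ∈ I, ∀ (π : M.Policy) i, |RiskCMDP.value π i (t i)| ≤ K := fun t ht π i =>
    RiskCMDP.abs_value_le π (hC t ht i)
  rcases le_or_gt ε ε₀ with hle | hgt
  · refine le_iSup₂_of_le (f := fun t (_ : t ∈ I) => ⨅ l : Fin m → ℝ≥0, ⨆ θ : Θ,
      ((RiskCMDP.lagrangian (pol θ) t l : ℝ) : EReal)) tstar hCQ.mem_I (le_iInf fun l => ?_)
    have hηδ : D * ε ≤ δ / 2 := by
      have h1 : ε₀ * (2 * (D + 1)) = δ := div_mul_cancel₀ _ (by positivity)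
      have h2 := mul_le_mul_of_nonneg_left hle hD
      linarith
    obtain ⟨θ, hθ⟩ := RiskCMDP.exists_lagrangian_ge hK hδ (mul_nonneg hD hε.le) hηδ
      (hval tstar hCQ.mem_I) hπ₀ (fun π' => by
        obtain ⟨θ, hθ⟩ := huniv π'
        exact ⟨θ, fun i => RiskCMDP.abs_value_sub_le hε.le hθ hC0 (hC tstar hCQ.mem_I i)⟩) hπ l
    refine le_iSup_of_le θ (EReal.coe_le_coe_iff.2 (le_trans ?_ hθ))
    have : (1 + (4 * K + δ) / δ) * (D * ε) = G₁ * ε := by ring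
    linarith
  -- Here `ε > ε₀`, so the allowed loss exceeds `2 * K`, the largest possible gap between two
  -- objective values over `I`.
  · obtain ⟨θ, t, ht, hf⟩ := hor.resolve_left hgt.not_ge
    refine le_iSup₂_of_le (f := fun t (_ : t ∈ I) => ⨅ l : Fin m → ℝ≥0, ⨆ θ : Θ,
      ((RiskCMDP.lagrangian (pol θ) t l : ℝ) : EReal)) t ht (le_iInf fun l => ?_)
    refine le_iSup_of_le θ (EReal.coe_le_coe_iff.2 (le_trans ?_ (RiskCMDP.value_le_lagrangian hf l)))
    have h1 := (abs_le.1 (hval t ht (pol θ) 0)).1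
    have h2 := (abs_le.1 (hval tstar hCQ.mem_I π 0)).2
    have h3 : 2 * K / ε₀ * ε₀ ≤ 2 * K / ε₀ * ε := mul_le_mul_of_nonneg_left hgt.le (by positivity)
    rw [div_mul_cancel₀ _ hε₀.ne'] at h3
    linarith
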